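/- Let $d\ge 3$ and $m\ge 2$ be integers. Let $\mathfrak{su}(d)$ denote the real vector space, of dimension $d^2-1$, of traceless Hermitian $d\times d$ complex matrices, and let $\hat\lambda_1,\dots,\hat\lambda_{d^2-1}$ be a basis of it with $\mathrm{Tr}(\hat\lambda_i\hat\lambda_j)=2\delta_{ij}$ (for example the generalized Gell-Mann basis). Let $d_{ijk}=\tfrac14\mathrm{Tr}\big((\hat\lambda_i\hat\lambda_j+\hat\lambda_j\hat\lambda_i)\hat\lambda_k\big)$ be the totally symmetric structure constants. The Bloch vector of $H\in\mathfrak{su}(d)$ is the vector $\vec b\in\mathbb{R}^{d^2-1}$ with $H=\sum_i b_i\hat\lambda_i$, and the star product of $\vec a,\vec b\in\mathbb{R}^{d^2-1}$ is the vector $\vec a*\vec b\in\mathbb{R}^{d^2-1}$ with components $(\vec a*\vec b)_\xi=\sum_{\mu,\nu}d_{\mu\nu\xi}a_\mu b_\nu$; it is commutative but not associative. For $S=(H_1,\dots,H_m)\in\mathfrak{su}(d)^m$ with Bloch vectors $B=\{\vec b^{(1)},\dots,\vec b^{(m)}\}$, let $\mathcal{B}$ be the set of all possible iterated star products of elements of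 $B$, that is, the smallest subset of $\mathbb{R}^{d^2-1}$ that contains $B$ and is closed under $*$. Then for almost every $S$, that is, for all $S\in\mathfrak{su}(d)^m$ outside a set of Lebesgue measure zero, $$\dim(\mathrm{span}_{\mathbb{R}}(\mathcal{B}))=d^2-1,$$ so that $\mathcal{B}$ spans the full Bloch vector space $\mathbb{R}^{d^2-1}$. -/

import Mathlib

open MeasureTheory

/-- The real vector space of traceless Hermitian `d × d` matrices (`𝔰𝔲(d)` in the physicists'
convention). -/
def TracelessHermitian (d : ℕ) : Submodule ℝ (Matrix (Fin d) (Fin d) ℂ) where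
  carrier := {H | H.IsHermitian ∧ H.trace = 0}
  add_mem' := fun ha hb => ⟨ha.1.add hb.1, by simp [ha.2, hb.2]⟩
  zero_mem' := by simp
  smul_mem' := fun c H hH => ⟨by
    have := hH.1
    simp [Matrix.IsHermitian, Matrix.conjTranspose_smul, this.eq], by simp [Matrix.trace_smul, hH.2]⟩

/-- The Borel σ-algebra of the (usual, entrywise) topology. -/
noncomputable instance TracelessHermitian.instMeasurableSpace (d : ℕ) :
    MeasurableSpace (TracelessHermitian d) := borel _

instance TracelessHermitian.instBorelSpace (d : ℕ) : BorelSpace (TracelessHermitian d) := ⟨rfl⟩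

instance TracelessHermitian.instSecondCountable (d : ℕ) :
    SecondCountableTopology (TracelessHermitian d) :=
  haveI : SecondCountableTopology (Matrix (Fin d) (Fin d) ℂ) :=
    inferInstanceAs (SecondCountableTopology (Fin d → Fin d → ℂ))
  TopologicalSpace.Subtype.secondCountableTopology
    (fun x : Matrix (Fin d) (Fin d) ℂ => x ∈ TracelessHermitian d)

namespace Bloch

variable {d : ℕ} {ι : Type*}

/-- The standard normalization `Tr(λᵢ λⱼ) = 2 δᵢⱼ` of a basis of `𝔰𝔲(d)`. -/
def IsNormalized (lam : Module.Basis ι ℝ (TracelessHermitian d)) : Prop :=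
  (∀ i, ((lam i : Matrix (Fin d) (Fin d) ℂ) * (lam i : Matrix (Fin d) (Fin d) ℂ)).trace = 2) ∧
  ∀ i j, i ≠ j →
    ((lam i : Matrix (Fin d) (Fin d) ℂ) * (lam j : Matrix (Fin d) (Fin d) ℂ)).trace = 0

/-- The Bloch vector of `H`: the real coordinates `b` with `H = ∑ᵢ bᵢ λᵢ`. -/
noncomputable def blochVector [Fintype ι] (lam : Module.Basis ι ℝ (TracelessHermitian d))
    (H : TracelessHermitian d) : ι → ℝ :=
  lam.equivFun H

/-- The symmetric structure constants `d_{ijk} = Tr({λᵢ, λⱼ} λₖ) / 4`. -/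
noncomputable def symmConst (lam : Module.Basis ι ℝ (TracelessHermitian d)) (i j k : ι) : ℝ :=
  (((lam i : Matrix (Fin d) (Fin d) ℂ) * lam j + (lam j : Matrix (Fin d) (Fin d) ℂ) * lam i)
    * lam k).trace.re / 4

/-- The antisymmetric structure constants `f_{ijk} = Tr([λᵢ, λⱼ] λₖ) / (4 i)`. They enter only
`basis_mul_basis` below. -/
noncomputable def antisymmConst (lam : Module.Basis ι ℝ (TracelessHermitian d)) (i j k : ι) : ℝ :=
  (((lam i : Matrix (Fin d) (Fin d) ℂ) * lam j - (lam j : Matrix (Fin d) (Fin d) ℂ) * lam i)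
    * lam k).trace.im / 4

/-- The star product `(a * b)_ξ = ∑_{μ, ν} d_{μνξ} a_μ b_ν` on Bloch space. -/
noncomputable def starProd [Fintype ι] (lam : Module.Basis ι ℝ (TracelessHermitian d))
    (a b : ι → ℝ) : ι → ℝ :=
  fun ξ => ∑ μ, ∑ ν, symmConst lam μ ν ξ * a μ * b ν

/-- The set of all iterated star products (with arbitrary bracketing, including the single factors)
of elements of `B`. -/
inductive starProducts [Fintype ι] (lam : Module.Basis ι ℝ (TracelessHermitian d))
    (B : Set (ι → ℝ)) : Set (ι → ℝ)
  | base {b : ι → ℝ} (hb : b ∈ B) : starProducts lam B b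
  | mul {a b : ι → ℝ} (ha : starProducts lam B a) (hb : starProducts lam B b) :
      starProducts lam B (starProd lam a b)


theorem trace_conj (lam : Module.Basis ι ℝ (TracelessHermitian d)) (i : ι) :
    (lam i : Matrix (Fin d) (Fin d) ℂ).conjTranspose = lam i := (lam i).2.1

theorem expand_hermitian [Fintype ι] (lam : Module.Basis ι ℝ (TracelessHermitian d))
    (h : IsNormalized lam) (H : TracelessHermitian d) :
    (H : Matrix (Fin d) (Fin d) ℂ) =
      ∑ k, (((H : Matrix (Fin d) (Fin d) ℂ) * lam k).trace / 2) •
        (lam k : Matrix (Fin d) (Fin d) ℂ) := by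
  classical
  have e : (H : Matrix (Fin d) (Fin d) ℂ) =
      ∑ k, ((lam.equivFun H k : ℝ) : ℂ) • (lam k : Matrix (Fin d) (Fin d) ℂ) := by
    conv_lhs => rw [← lam.sum_equivFun H]
    simp only [Submodule.coe_sum, Submodule.coe_smul]
    rfl
  have c : ∀ k, ((H : Matrix (Fin d) (Fin d) ℂ) * lam k).trace / 2 = (lam.equivFun H k : ℝ) := by
    intro k
    rw [e, Finset.sum_mul, Matrix.trace_sum, Finset.sum_eq_single k]
    · rw [Matrix.smul_mul, Matrix.trace_smul, h.1, smul_eq_mul]; ring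
    · intro j _ hj
      rw [Matrix.smul_mul, Matrix.trace_smul, h.2 j k hj, smul_zero]
    · simp
  simp only [c]
  exact e

theorem expand_traceless [Fintype ι] (lam : Module.Basis ι ℝ (TracelessHermitian d))
    (h : IsNormalized lam) (M : Matrix (Fin d) (Fin d) ℂ) (hM : M.trace = 0) :
    M = ∑ k, ((M * lam k).trace / 2) • (lam k : Matrix (Fin d) (Fin d) ℂ) := by
  have hMc : M.conjTranspose.trace = 0 := by simp [Matrix.trace_conjTranspose, hM]
  have hA : M + M.conjTranspose ∈ TracelessHermitian d := by
    refine ⟨?_, ?_⟩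
    · simp [Matrix.IsHermitian, add_comm]
    · simp [hM, hMc]
  have hB : Complex.I • (M - M.conjTranspose) ∈ TracelessHermitian d := by
    refine ⟨?_, ?_⟩
    · simp only [Matrix.IsHermitian, Matrix.conjTranspose_smul, Matrix.conjTranspose_sub,
        Matrix.conjTranspose_conjTranspose]
      rw [← neg_sub M, smul_neg, ← neg_smul]
      simp
    · simp [hM, hMc]
  have eA := expand_hermitian lam h ⟨_, hA⟩
  have eB := expand_hermitian lam h ⟨_, hB⟩
  have eM : M = (1 / 2 : ℂ) • (M + M.conjTranspose) +
      (-Complex.I / 2) • (Complex.I • (M - M.conjTranspose)) := by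
    rw [smul_smul, show -Complex.I / 2 * Complex.I = 1 / 2 by
      rw [div_mul_eq_mul_div, neg_mul, Complex.I_mul_I]; norm_num]
    module
  simp only at eA eB
  conv_lhs => rw [eM, eA, eB]
  rw [Finset.smul_sum, Finset.smul_sum, ← Finset.sum_add_distrib]
  refine Finset.sum_congr rfl fun k _ => ?_
  rw [smul_smul, smul_smul, ← add_smul]
  congr 1
  conv_rhs => rw [eM]
  simp only [Matrix.add_mul, Matrix.smul_mul, Matrix.trace_add, Matrix.trace_smul, smul_eq_mul]
  ring

/-- The structure constants satisfy (and are determined by) the product formula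
`λᵢ λⱼ = (2/d) δᵢⱼ I + ∑ₖ (i f_{ijk} + d_{ijk}) λₖ`. -/
theorem basis_mul_basis [Fintype ι] [DecidableEq ι]
    (lam : Module.Basis ι ℝ (TracelessHermitian d)) (h : IsNormalized lam) (i j : ι) :
    (lam i : Matrix (Fin d) (Fin d) ℂ) * lam j =
      (if i = j then (2 / d : ℂ) else 0) • (1 : Matrix (Fin d) (Fin d) ℂ) +
      ∑ k, (Complex.I * antisymmConst lam i j k + symmConst lam i j k) •
        (lam k : Matrix (Fin d) (Fin d) ℂ) := by
  rcases Nat.eq_zero_or_pos d with rfl | hd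
  · ext a; exact a.elim0
  have ht : ((lam i : Matrix (Fin d) (Fin d) ℂ) * lam j -
      (if i = j then (2 / d : ℂ) else 0) • (1 : Matrix (Fin d) (Fin d) ℂ)).trace = 0 := by
    have : (d : ℂ) ≠ 0 := by exact_mod_cast hd.ne'
    by_cases hij : i = j
    · subst hij
      rw [Matrix.trace_sub, h.1]
      simp [this]
    · simp [hij, h.2 i j hij]
  have e := expand_traceless lam h _ ht
  rw [sub_eq_iff_eq_add'] at e
  rw [e]
  congr 1
  refine Finset.sum_congr rfl fun k _ => ?_
  congr 1
  rw [Matrix.sub_mul, Matrix.trace_sub, Matrix.smul_mul, Matrix.trace_smul, Matrix.one_mul,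
    (lam k).2.2, smul_zero, sub_zero]
  have hc : star ((lam i : Matrix (Fin d) (Fin d) ℂ) * lam j * lam k).trace =
      ((lam j : Matrix (Fin d) (Fin d) ℂ) * lam i * lam k).trace := by
    rw [← Matrix.trace_conjTranspose, Matrix.conjTranspose_mul, Matrix.conjTranspose_mul,
      trace_conj, trace_conj, trace_conj, Matrix.trace_mul_comm]
  rw [antisymmConst, symmConst, Matrix.sub_mul, Matrix.add_mul, Matrix.trace_add,
    Matrix.trace_sub, ← hc]
  apply Complex.ext
  · simp
    ring
  · simp
    ring

/-- Index set of the generalized Gell-Mann matrices: symmetric, skew-symmetric, diagonal. -/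
abbrev GellMannIndex (d : ℕ) : Type :=
  ({p : Fin d × Fin d // p.1 < p.2} ⊕ {p : Fin d × Fin d // p.1 < p.2}) ⊕ Fin (d - 1)

/-- The generalized Gell-Mann matrices `|j⟩⟨k| + |k⟩⟨j|`, `-i|j⟩⟨k| + i|k⟩⟨j|` (`j < k`) and
`√(2/(l(l+1))) diag(1, …, 1, -l, 0, …, 0)` with `l = 1, …, d-1` ones. -/
noncomputable def gellMann (d : ℕ) : GellMannIndex d → Matrix (Fin d) (Fin d) ℂ
  | .inl (.inl p) => Matrix.single p.1.1 p.1.2 1 + Matrix.single p.1.2 p.1.1 1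
  | .inl (.inr p) =>
      Matrix.single p.1.1 p.1.2 (-Complex.I) + Matrix.single p.1.2 p.1.1 Complex.I
  | .inr l => ((Real.sqrt (2 / (((l : ℝ) + 1) * ((l : ℝ) + 2))) : ℝ) : ℂ) •
      Matrix.diagonal fun a : Fin d =>
        if (a : ℕ) < l + 1 then 1 else if (a : ℕ) = l + 1 then -((l : ℂ) + 1) else 0

theorem sum_diag_aux (d : ℕ) (g : Fin d → ℂ) (l : Fin (d - 1)) :
    ∑ a : Fin d, (if (a : ℕ) < l + 1 then 1 else
      if (a : ℕ) = l + 1 then -((l : ℂ) + 1) else 0) * g a =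
    (∑ a : Fin d, if (a : ℕ) < l + 1 then g a else 0) - ((l : ℂ) + 1) * g ⟨l + 1, by omega⟩ := by
  have hl : (l : ℕ) + 1 < d := by omega
  have e : -((l : ℂ) + 1) * g ⟨l + 1, hl⟩ =
      ∑ a, if a = (⟨l + 1, hl⟩ : Fin d) then -((l : ℂ) + 1) * g a else 0 := by simp
  rw [sub_eq_add_neg, ← neg_mul, e, ← Finset.sum_add_distrib]
  refine Finset.sum_congr rfl fun a _ => ?_
  by_cases h1 : (a : ℕ) < l + 1
  · have : a ≠ ⟨l + 1, hl⟩ := by rintro rfl; simp at h1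
    simp [h1, this]
  · by_cases h2 : (a : ℕ) = l + 1
    · have : a = ⟨l + 1, hl⟩ := Fin.ext h2
      simp [this]
    · have : a ≠ ⟨l + 1, hl⟩ := by rintro rfl; simp at h2
      simp [h1, h2, this]

theorem card_lt_aux (d n : ℕ) (hn : n ≤ d) (c : ℂ) :
    (∑ a : Fin d, if (a : ℕ) < n then c else 0) = n * c := by
  rw [Fin.sum_univ_eq_sum_range (fun a => if a < n then c else 0) d, Finset.sum_ite]
  have : (Finset.range d).filter (fun a => a < n) = Finset.range n := by
    ext a; simp; omega
  simp [this]

theorem gellMann_mem (d : ℕ) (i : GellMannIndex d) : gellMann d i ∈ TracelessHermitian d := by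
  rcases i with (p | p) | l
  · refine ⟨?_, ?_⟩
    · simp [gellMann, Matrix.IsHermitian, add_comm]
    · have := p.2.ne
      simp [gellMann, Matrix.trace_single_eq_of_ne, this, this.symm]
  · refine ⟨?_, ?_⟩
    · simp [gellMann, Matrix.IsHermitian, add_comm]
    · have := p.2.ne
      simp [gellMann, Matrix.trace_single_eq_of_ne, this, this.symm]
  · refine ⟨?_, ?_⟩
    · simp only [gellMann, Matrix.IsHermitian, Matrix.conjTranspose_smul,
        Matrix.diagonal_conjTranspose]
      congr 1
      · simp
      · congr 1
        ext a
        simp only [Pi.star_apply]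
        split_ifs <;> simp
    · have h := sum_diag_aux d (fun _ => 1) l
      rw [card_lt_aux d (l + 1) (by omega)] at h
      simp only [mul_one] at h
      rw [gellMann, Matrix.trace_smul, Matrix.trace_diagonal, h]
      simp

theorem trace_mul_gellMann_diag (d : ℕ) (M : Matrix (Fin d) (Fin d) ℂ) (l : Fin (d - 1)) :
    (M * gellMann d (.inr l)).trace =
      ((Real.sqrt (2 / (((l : ℝ) + 1) * ((l : ℝ) + 2))) : ℝ) : ℂ) *
      ((∑ a : Fin d, if (a : ℕ) < l + 1 then M a a else 0) -
        ((l : ℂ) + 1) * M ⟨l + 1, by omega⟩ ⟨l + 1, by omega⟩) := by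
  rw [← sum_diag_aux d (fun a => M a a) l]
  rw [gellMann, Matrix.mul_smul, Matrix.trace_smul, smul_eq_mul, Matrix.trace]
  congr 1
  refine Finset.sum_congr rfl fun a _ => ?_
  rw [Matrix.diag_apply, Matrix.mul_diagonal, mul_comm]

theorem trace_mul_gellMann_symm (d : ℕ) (M : Matrix (Fin d) (Fin d) ℂ)
    (p : {p : Fin d × Fin d // p.1 < p.2}) :
    (M * gellMann d (.inl (.inl p))).trace = M p.1.2 p.1.1 + M p.1.1 p.1.2 := by
  simp [gellMann, Matrix.mul_add, Matrix.trace_mul_single]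

theorem trace_mul_gellMann_skew (d : ℕ) (M : Matrix (Fin d) (Fin d) ℂ)
    (p : {p : Fin d × Fin d // p.1 < p.2}) :
    (M * gellMann d (.inl (.inr p))).trace =
      Complex.I * (M p.1.1 p.1.2 - M p.1.2 p.1.1) := by
  simp [gellMann, Matrix.mul_add, Matrix.trace_mul_single]
  ring

theorem gellMann_diag_apply_ne (d : ℕ) (l : Fin (d - 1)) {a b : Fin d} (h : a ≠ b) :
    gellMann d (.inr l) a b = 0 := by
  simp [gellMann, h]

theorem gellMann_off_apply_self (d : ℕ)
    (q : {p : Fin d × Fin d // p.1 < p.2} ⊕ {p : Fin d × Fin d // p.1 < p.2}) (a : Fin d) :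
    gellMann d (.inl q) a a = 0 := by
  rcases q with p | p
  · have := p.2.ne
    simp only [gellMann, Matrix.add_apply, Matrix.single_apply]
    rw [if_neg, if_neg, add_zero] <;> rintro ⟨h1, h2⟩
    · exact this (h2.trans h1.symm)
    · exact this (h1.trans h2.symm)
  · have := p.2.ne
    simp only [gellMann, Matrix.add_apply, Matrix.single_apply]
    rw [if_neg, if_neg, add_zero] <;> rintro ⟨h1, h2⟩
    · exact this (h2.trans h1.symm)
    · exact this (h1.trans h2.symm)

theorem gellMann_diag_lt (d : ℕ) {l m : Fin (d - 1)} (h : l < m) :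
    (gellMann d (.inr m) * gellMann d (.inr l)).trace = 0 := by
  have hlm : (l : ℕ) < m := h
  set c : ℂ := ((Real.sqrt (2 / (((m : ℝ) + 1) * ((m : ℝ) + 2))) : ℝ) : ℂ) with hc
  have h1 : ∀ a : Fin d, (a : ℕ) < m + 1 → gellMann d (.inr m) a a = c := by
    intro a ha
    rw [gellMann, Matrix.smul_apply, Matrix.diagonal_apply_eq, if_pos ha, smul_eq_mul, mul_one]
  have h2 : (∑ a : Fin d, if (a : ℕ) < l + 1 then gellMann d (.inr m) a a else 0) =
      ∑ a : Fin d, if (a : ℕ) < l + 1 then c else 0 := by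
    refine Finset.sum_congr rfl fun a _ => ?_
    split_ifs with ha
    · exact h1 a (by omega)
    · rfl
  rw [trace_mul_gellMann_diag, h2, card_lt_aux d (l + 1) (by omega), h1 _ (by simpa using hlm)]
  push_cast
  ring

theorem gellMann_trace_self (d : ℕ) (i : GellMannIndex d) :
    (gellMann d i * gellMann d i).trace = 2 := by
  rcases i with (p | p) | l
  · have := p.2.ne
    simp [gellMann, Matrix.mul_add, Matrix.add_mul, this, this.symm]
    norm_num
  · have := p.2.ne
    simp [gellMann, Matrix.mul_add, Matrix.add_mul, this, this.symm]
    norm_num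
  · have hc : ((Real.sqrt (2 / (((l : ℝ) + 1) * ((l : ℝ) + 2))) : ℝ) : ℂ) ^ 2 =
        2 / (((l : ℂ) + 1) * ((l : ℂ) + 2)) := by
      rw [← Complex.ofReal_pow, Real.sq_sqrt (by positivity)]
      push_cast
      rfl
    set c : ℂ := ((Real.sqrt (2 / (((l : ℝ) + 1) * ((l : ℝ) + 2))) : ℝ) : ℂ) with hc'
    have h2 : (∑ a : Fin d, if (a : ℕ) < l + 1 then gellMann d (.inr l) a a else 0) =
        ∑ a : Fin d, if (a : ℕ) < l + 1 then c else 0 := by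
      refine Finset.sum_congr rfl fun a _ => ?_
      split_ifs with ha
      · rw [gellMann, Matrix.smul_apply, Matrix.diagonal_apply_eq, if_pos ha, smul_eq_mul, mul_one]
      · rfl
    have h3 : gellMann d (.inr l) ⟨l + 1, by omega⟩ ⟨l + 1, by omega⟩ = c * -((l : ℂ) + 1) := by
      rw [gellMann, Matrix.smul_apply, Matrix.diagonal_apply_eq, if_neg (by simp), if_pos rfl,
        smul_eq_mul]
    rw [trace_mul_gellMann_diag, h2, card_lt_aux d (l + 1) (by omega), h3]
    have n1 : (l : ℂ) + 1 ≠ 0 := by exact_mod_cast Nat.succ_ne_zero l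
    have n2 : (l : ℂ) + 2 ≠ 0 := by exact_mod_cast Nat.succ_ne_zero (l + 1)
    rw [← hc']
    calc _ = c ^ 2 * (((l : ℂ) + 1) * ((l : ℂ) + 2)) := by push_cast; ring
      _ = 2 := by rw [hc]; field_simp

theorem gellMann_trace_off (d : ℕ) (i : GellMannIndex d)
    (q : {p : Fin d × Fin d // p.1 < p.2} ⊕ {p : Fin d × Fin d // p.1 < p.2}) (h : i ≠ .inl q) :
    (gellMann d i * gellMann d (.inl q)).trace = 0 := by
  rcases q with p | p
  · rw [trace_mul_gellMann_symm]
    rcases i with (⟨⟨a, b⟩, r⟩ | ⟨⟨a, b⟩, r⟩) | l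
    · obtain ⟨⟨u, v⟩, s⟩ := p
      simp only [gellMann, Matrix.add_apply, Matrix.single_apply]
      simp only [ne_eq, Sum.inl.injEq, Subtype.mk.injEq, Prod.mk.injEq] at h
      simp only at r s
      rw [if_neg (by omega), if_neg (by omega), if_neg (by omega), if_neg (by omega)]
      simp
    · simp only [gellMann, Matrix.add_apply, Matrix.single_apply]
      simp only [and_comm]
      split_ifs <;> simp
    · rw [gellMann_diag_apply_ne d l p.2.ne, gellMann_diag_apply_ne d l p.2.ne', add_zero]
  · rw [trace_mul_gellMann_skew]
    rcases i with (⟨⟨a, b⟩, r⟩ | ⟨⟨a, b⟩, r⟩) | l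
    · simp only [gellMann, Matrix.add_apply, Matrix.single_apply]
      simp only [and_comm]
      split_ifs <;> simp
    · obtain ⟨⟨u, v⟩, s⟩ := p
      simp only [gellMann, Matrix.add_apply, Matrix.single_apply]
      simp only [ne_eq, Sum.inl.injEq, Sum.inr.injEq, Subtype.mk.injEq, Prod.mk.injEq] at h
      simp only at r s
      rw [if_neg (by omega), if_neg (by omega), if_neg (by omega), if_neg (by omega)]
      simp
    · rw [gellMann_diag_apply_ne d l p.2.ne, gellMann_diag_apply_ne d l p.2.ne', sub_zero, mul_zero]

theorem gellMann_trace_ne (d : ℕ) (i j : GellMannIndex d) (h : i ≠ j) :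
    (gellMann d i * gellMann d j).trace = 0 := by
  rcases j with q | l
  · exact gellMann_trace_off d i q h
  · rcases i with q | m
    · rw [Matrix.trace_mul_comm]
      exact gellMann_trace_off d _ q h.symm
    · rcases lt_trichotomy l m with hlm | rfl | hlm
      · exact gellMann_diag_lt d hlm
      · exact absurd rfl h
      · rw [Matrix.trace_mul_comm]
        exact gellMann_diag_lt d hlm

theorem eq_zero_of_gellMann (d : ℕ) (M : Matrix (Fin d) (Fin d) ℂ) (hM : M.trace = 0)
    (h : ∀ i, (M * gellMann d i).trace = 0) : M = 0 := by
  have off : ∀ a b : Fin d, a < b → M a b = 0 ∧ M b a = 0 := by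
    intro a b hab
    have h1 := h (.inl (.inl ⟨(a, b), hab⟩))
    have h2 := h (.inl (.inr ⟨(a, b), hab⟩))
    rw [trace_mul_gellMann_symm] at h1
    rw [trace_mul_gellMann_skew] at h2
    have h3 := (mul_eq_zero.mp h2).resolve_left Complex.I_ne_zero
    simp only at h1 h3
    exact ⟨by linear_combination h1 / 2 + h3 / 2, by linear_combination h1 / 2 - h3 / 2⟩
  have dia : ∀ n (hn : n < d), M ⟨n, hn⟩ ⟨n, hn⟩ = M ⟨0, by omega⟩ ⟨0, by omega⟩ := by
    intro n
    induction n using Nat.strong_induction_on with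
    | _ n ih =>
      intro hn
      rcases n with _ | n
      · rfl
      · have h1 := h (.inr ⟨n, by omega⟩)
        rw [trace_mul_gellMann_diag] at h1
        have hc : ((Real.sqrt (2 / (((n : ℝ) + 1) * ((n : ℝ) + 2))) : ℝ) : ℂ) ≠ 0 := by
          rw [Complex.ofReal_ne_zero]
          positivity
        have h2 := (mul_eq_zero.mp h1).resolve_left hc
        have h3 : (∑ a : Fin d, if (a : ℕ) < n + 1 then M a a else 0) =
            ∑ a : Fin d, if (a : ℕ) < n + 1 then M ⟨0, by omega⟩ ⟨0, by omega⟩ else 0 := by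
          refine Finset.sum_congr rfl fun a _ => ?_
          split_ifs with ha
          · exact ih a ha a.2
          · rfl
        simp only at h2
        rw [h3, card_lt_aux d (n + 1) (by omega)] at h2
        have n1 : (n : ℂ) + 1 ≠ 0 := by exact_mod_cast Nat.succ_ne_zero n
        push_cast at h2
        rw [← mul_sub] at h2
        exact (sub_eq_zero.mp ((mul_eq_zero.mp h2).resolve_left n1)).symm
  ext a b
  rcases lt_trichotomy a b with hab | rfl | hab
  · exact (off a b hab).1
  · have hd : 0 < d := by have := a.2; omega
    have h0 : M ⟨0, hd⟩ ⟨0, hd⟩ = 0 := by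
      have e : M.trace = d * M ⟨0, hd⟩ ⟨0, hd⟩ := by
        have e' : ∀ b : Fin d, M.diag b = M ⟨0, hd⟩ ⟨0, hd⟩ := fun b => dia b b.2
        rw [Matrix.trace, Finset.sum_congr rfl fun b _ => e' b]
        simp
      rw [hM] at e
      exact (mul_eq_zero.mp e.symm).resolve_left (by exact_mod_cast hd.ne')
    exact (dia a a.2).trans h0
  · exact (off b a hab).2

theorem gellMann_linearIndependent (d : ℕ) :
    LinearIndependent ℝ (fun i => (⟨gellMann d i, gellMann_mem d i⟩ : TracelessHermitian d)) := by
  rw [Fintype.linearIndependent_iff]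
  intro g hg i
  have h1 := congrArg (fun H : TracelessHermitian d =>
    ((H : Matrix (Fin d) (Fin d) ℂ) * gellMann d i).trace) hg
  simp only [Submodule.coe_sum, Submodule.coe_smul, Finset.sum_mul, Matrix.trace_sum,
    Matrix.smul_mul, Matrix.trace_smul, ZeroMemClass.coe_zero, zero_mul, Matrix.trace_zero] at h1
  rw [Finset.sum_eq_single i (fun j _ hj => by rw [gellMann_trace_ne d j i hj, smul_zero])
    (by simp), gellMann_trace_self] at h1
  simpa using h1

theorem gellMann_span (d : ℕ) :
    ⊤ ≤ Submodule.span ℝ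
      (Set.range fun i => (⟨gellMann d i, gellMann_mem d i⟩ : TracelessHermitian d)) := by
  intro H _
  set v : GellMannIndex d → TracelessHermitian d := fun i => ⟨gellMann d i, gellMann_mem d i⟩
  set c : GellMannIndex d → ℝ :=
    fun i => ((H : Matrix (Fin d) (Fin d) ℂ) * gellMann d i).trace.re / 2 with hc
  have hre : ∀ i, ((H : Matrix (Fin d) (Fin d) ℂ) * gellMann d i).trace = ((2 * c i : ℝ) : ℂ) := by
    intro i
    have hs : star ((H : Matrix (Fin d) (Fin d) ℂ) * gellMann d i).trace =
        ((H : Matrix (Fin d) (Fin d) ℂ) * gellMann d i).trace := by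
      rw [← Matrix.trace_conjTranspose, Matrix.conjTranspose_mul, H.2.1.eq,
        (gellMann_mem d i).1.eq, Matrix.trace_mul_comm]
    rw [← Complex.conj_eq_iff_re.mp hs, hc]
    congr 1
    simp
    ring
  have hK : H - ∑ i, c i • v i = 0 := by
    apply Subtype.ext
    refine eq_zero_of_gellMann d _ (H - ∑ i, c i • v i).2.2 fun i => ?_
    simp only [Submodule.coe_sub, Submodule.coe_sum, Submodule.coe_smul, Matrix.sub_mul,
      Matrix.trace_sub, Finset.sum_mul, Matrix.trace_sum, Matrix.smul_mul, Matrix.trace_smul, v]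
    rw [Finset.sum_eq_single i (fun j _ hj => by rw [gellMann_trace_ne d j i hj, smul_zero])
      (by simp), gellMann_trace_self, hre]
    simp
    ring
  rw [sub_eq_zero.mp hK]
  exact Submodule.sum_mem _ fun i _ => Submodule.smul_mem _ _ (Submodule.subset_span ⟨i, rfl⟩)

/-- The generalized Gell-Mann basis of `𝔰𝔲(d)`. -/
noncomputable def gellMannBasis (d : ℕ) :
    Module.Basis (GellMannIndex d) ℝ (TracelessHermitian d) :=
  Module.Basis.mk (gellMann_linearIndependent d) (gellMann_span d)

theorem gellMannBasis_isNormalized (d : ℕ) : IsNormalized (gellMannBasis d) := by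
  refine ⟨fun i => ?_, fun i j hij => ?_⟩
  · simpa [gellMannBasis] using gellMann_trace_self d i
  · simpa [gellMannBasis] using gellMann_trace_ne d i j hij

end Bloch

/-! Under the Bloch correspondence the star product is half the Jordan product `A * B + B * A` with
its trace removed (`blochMatrix_jordan`). Hence the span of all iterated star products, enlarged by
the real multiples of `1`, is a real space `J` of matrices closed under the Jordan product.

One generating pair suffices to start: a traceless real diagonal matrix with distinct entries, and
`skewOnes d`. Polynomials in the former give the diagonal units, these cut the latter into its
individual 2 × 2 blocks, and Jordan products of overlapping blocks give the real symmetric units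
(`hermitian_mem_of_jordan`). The overlap needs a third index, hence `3 ≤ d`; for `d = 2` the star
product vanishes identically.

Genericity follows from analyticity: select iterated products forming a basis at the special family.
The determinant of the same bracketed expressions is analytic in the family and nonzero at one
point, so it vanishes only on a null set (`AnalyticOnNhd.ae_ne_zero`). -/

/-- The Hermitian matrix with entries `i` above and `-i` below the diagonal. -/
noncomputable def skewOnes (d : ℕ) : Matrix (Fin d) (Fin d) ℂ :=
  Matrix.of fun i j => if i < j then Complex.I else if j < i then -Complex.I else 0

theorem skewOnes_mem (d : ℕ) : skewOnes d ∈ TracelessHermitian d := by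
  refine ⟨?_, ?_⟩
  · ext i j
    rcases lt_trichotomy i j with h | rfl | h
    · simp [skewOnes, h, h.not_gt]
    · simp [skewOnes]
    · simp [skewOnes, h, h.not_gt]
  · simp [skewOnes, Matrix.trace]

/-! ### Jordan-closed real spaces of matrices. -/

section Jordan

variable {d : ℕ} {J : Submodule ℝ (Matrix (Fin d) (Fin d) ℂ)}

/-- Powers of a single matrix commute, so half the Jordan product of `A ^ n` and `A` is `A ^ (n +
1)`. -/
theorem aeval_mem_of_jordan (hJ : ∀ X ∈ J, ∀ Y ∈ J, X * Y + Y * X ∈ J) (h1 : 1 ∈ J)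
    {A : Matrix (Fin d) (Fin d) ℂ} (hA : A ∈ J) (p : Polynomial ℝ) :
    Polynomial.aeval A p ∈ J := by
  have hpow : ∀ n : ℕ, A ^ n ∈ J := by
    intro n
    induction n with
    | zero => simpa using h1
    | succ n ih =>
      have h := J.smul_mem (1 / 2 : ℝ) (hJ _ ih _ hA)
      have e : (1 / 2 : ℝ) • (A ^ n * A + A * A ^ n) = A ^ (n + 1) := by
        rw [← pow_succ, ← pow_succ', ← two_smul ℝ, smul_smul]
        norm_num
      rwa [e] at h
  rw [Polynomial.aeval_eq_sum_range]
  exact J.sum_mem fun n _ => J.smul_mem _ (hpow n)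

/-- The diagonal unit is the value at the diagonal matrix of the Lagrange polynomial that is 1 at `a
i` and 0 at the other entries; distinctness of the entries makes it available. -/
theorem single_mem_of_jordan (hJ : ∀ X ∈ J, ∀ Y ∈ J, X * Y + Y * X ∈ J) (h1 : 1 ∈ J)
    {a : Fin d → ℝ} (ha : Function.Injective a)
    (hA : Matrix.diagonal (fun i => (a i : ℂ)) ∈ J) (i : Fin d) : Matrix.single i i 1 ∈ J := by
  obtain ⟨p, hp⟩ : ∃ p : Polynomial ℝ, ∀ j, p.eval (a j) = if i = j then 1 else 0 := by
    refine ⟨Lagrange.basis Finset.univ a i, fun j => ?_⟩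
    split_ifs with h
    · subst h
      exact Lagrange.eval_basis_self ha.injOn (Finset.mem_univ _)
    · exact Lagrange.eval_basis_of_ne h (Finset.mem_univ _)
  have h := aeval_mem_of_jordan hJ h1 hA p
  have e : Polynomial.aeval (Matrix.diagonal fun i => (a i : ℂ)) p =
      Matrix.diagonal fun j => ((p.eval (a j) : ℝ) : ℂ) := by
    have h2 := Polynomial.aeval_algHom_apply
      (Matrix.diagonalAlgHom ℝ (n := Fin d) (α := ℂ)) (fun i => (a i : ℂ)) p
    have h3 : Polynomial.aeval (fun i => (a i : ℂ)) p = fun j => ((p.eval (a j) : ℝ) : ℂ) := by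
      funext j
      have h4 := Polynomial.aeval_algHom_apply
        (Pi.evalAlgHom ℝ (fun _ : Fin d => ℂ) j) (fun i => (a i : ℂ)) p
      simp only [Pi.evalAlgHom_apply] at h4
      rw [← h4]
      exact Polynomial.aeval_algebraMap_apply_eq_algebraMap_eval (A := ℂ) (a j) p
    rw [h3] at h2
    exact h2
  rw [e] at h
  convert h using 1
  rw [← Matrix.diagonal_single]
  congr 1
  funext j
  rw [hp]
  by_cases h : i = j
  · simp [h]
  · simp [h, Ne.symm h]

theorem hermitian_mem_of_jordan (hd : 3 ≤ d)
    (hJ : ∀ X ∈ J, ∀ Y ∈ J, X * Y + Y * X ∈ J) (h1 : 1 ∈ J)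
    {a : Fin d → ℝ} (ha : Function.Injective a)
    (hA : Matrix.diagonal (fun i => (a i : ℂ)) ∈ J) (hB : skewOnes d ∈ J)
    {H : Matrix (Fin d) (Fin d) ℂ} (hH : H.IsHermitian) : H ∈ J := by
  have hE := single_mem_of_jordan hJ h1 ha hA
  have hK : ∀ i j : Fin d, Matrix.single i j Complex.I - Matrix.single j i Complex.I ∈ J := by
    have key : ∀ i j : Fin d, i < j →
        Matrix.single i j Complex.I - Matrix.single j i Complex.I ∈ J := by
      intro i j hij
      -- Multiplying by `E_ii` and then by `E_jj` in the Jordan sense leaves only the `(i, j)` and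
      -- `(j, i)` entries of `skewOnes d`.
      have h := hJ _ (hE j) _ (hJ _ (hE i) _ hB)
      have e1 : (Matrix.single i i 1 : Matrix (Fin d) (Fin d) ℂ) * Matrix.single j j 1 = 0 :=
        Matrix.single_mul_single_of_ne _ _ _ _ hij.ne _
      have e2 : (Matrix.single j j 1 : Matrix (Fin d) (Fin d) ℂ) * Matrix.single i i 1 = 0 :=
        Matrix.single_mul_single_of_ne _ _ _ _ hij.ne' _
      have e : Matrix.single j j 1 * (Matrix.single i i 1 * skewOnes d +
          skewOnes d * Matrix.single i i 1) + (Matrix.single i i 1 * skewOnes d +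
          skewOnes d * Matrix.single i i 1) * Matrix.single j j 1 =
          Matrix.single j j 1 * skewOnes d * Matrix.single i i 1 +
          Matrix.single i i 1 * skewOnes d * Matrix.single j j 1 := by
        rw [mul_add, add_mul, ← mul_assoc, e2, mul_assoc (skewOnes d), e1, ← mul_assoc]
        simp
      rw [e, Matrix.single_mul_mul_single, Matrix.single_mul_mul_single] at h
      convert h using 1
      simp [skewOnes, hij, hij.not_gt, sub_eq_neg_add, ← Matrix.single_neg]
    intro i j
    rcases lt_trichotomy i j with h | rfl | h
    · exact key i j h
    · simp
    · simpa using J.neg_mem (key j i h)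
  have hS : ∀ i j : Fin d, Matrix.single i j (1 : ℂ) + Matrix.single j i 1 ∈ J := by
    intro i j
    by_cases hij : i = j
    · subst hij
      exact J.add_mem (hE i) (hE i)
    -- With a third index `k`, the products `K_ik K_kj` and `K_kj K_ik` equal `-E_ij` and `-E_ji`;
    -- this is where `3 ≤ d` enters.
    · obtain ⟨k, hk⟩ : ∃ k, k ∉ ({i, j} : Finset (Fin d)) := by
        by_contra! h
        have h2 := Finset.card_le_card (fun x _ => h x : Finset.univ ⊆ ({i, j} : Finset (Fin d)))
        have h3 := Finset.card_le_two (a := i) (b := j)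
        simp only [Finset.card_univ, Fintype.card_fin] at h2
        omega
      simp only [Finset.mem_insert, Finset.mem_singleton, not_or] at hk
      have h := J.neg_mem (hJ _ (hK i k) _ (hK k j))
      convert h using 1
      simp [mul_sub, sub_mul, hk.1, hk.2, hij, Ne.symm hk.1, Ne.symm hk.2, Ne.symm hij,
        ← Matrix.single_neg]
      exact add_comm _ _
  -- Averaging the entrywise expansion of `H` with that of its conjugate transpose.
  have e : H = (1 / 2 : ℝ) • ∑ i, ∑ j,
      ((H i j).re • (Matrix.single i j (1 : ℂ) + Matrix.single j i 1) +
       (H i j).im • (Matrix.single i j Complex.I - Matrix.single j i Complex.I)) := by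
    have e1 : H = ∑ i, ∑ j, Matrix.single i j (H i j) := Matrix.matrix_eq_sum_single H
    have e2 : H = ∑ i, ∑ j, Matrix.single j i (star (H i j)) := by
      rw [Finset.sum_comm]
      simp only [hH.apply]
      exact e1
    have e3 : H = (1 / 2 : ℝ) • (H + H) := by
      rw [← two_smul ℝ, smul_smul]
      norm_num
    conv_lhs => rw [e3]
    congr 1
    conv_lhs => rw [e1]
    conv_lhs => enter [2]; rw [← e1, e2]
    simp only [← Finset.sum_add_distrib]
    refine Finset.sum_congr rfl fun i _ => Finset.sum_congr rfl fun j _ => ?_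
    have h4 : ∀ (i j : Fin d) (z : ℂ), Matrix.single i j z =
        z.re • Matrix.single i j (1 : ℂ) + z.im • Matrix.single i j Complex.I := by
      intro i j z
      rw [Matrix.smul_single, Matrix.smul_single, ← Matrix.single_add]
      congr 1
      apply Complex.ext <;> simp
    rw [h4 i j, h4 j i]
    simp only [Complex.star_def, Complex.conj_re, Complex.conj_im]
    module
  rw [e]
  exact J.smul_mem _ (J.sum_mem fun i _ => J.sum_mem fun j _ =>
    J.add_mem (J.smul_mem _ (hS i j)) (J.smul_mem _ (hK i j)))

end Jordan

/-! ### Null zero sets of analytic functions. -/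

/-- The zero set of a nonzero real analytic function is null. -/
theorem AnalyticOnNhd.ae_ne_zero {E : Type*} [NormedAddCommGroup E] [NormedSpace ℝ E]
    [FiniteDimensional ℝ E] [MeasurableSpace E] [BorelSpace E] (ν : Measure E) [ν.IsAddHaarMeasure]
    {f : E → ℝ} (hf : AnalyticOnNhd ℝ f Set.univ) {p : E} (hp : f p ≠ 0) :
    ∀ᵐ x ∂ν, f x ≠ 0 := by
  have hc : Continuous f := continuousOn_univ.mp hf.continuousOn
  -- On each line through `p` the restriction is nonzero at `t = 0`, so its zero set has codiscrete
  -- complement, hence is null.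
  have line : ∀ x : E, ∀ᵐ t : ℝ, f (p + t • x) ≠ 0 := by
    intro x
    have hg : AnalyticOnNhd ℝ (fun t : ℝ => f (p + t • x)) Set.univ := by
      intro t _
      have h := hf (p + t • x) (Set.mem_univ _)
      exact h.comp_of_eq (g := f) (f := fun t : ℝ => p + t • x)
        (analyticAt_const.add (analyticAt_id.smul analyticAt_const)) rfl
    have h := hg.preimage_zero_mem_codiscrete (x := 0) (by simpa using hp)
    have h2 := ae_restrict_le_codiscreteWithin (μ := (volume : Measure ℝ)) (U := Set.univ)
      MeasurableSet.univ h
    rw [Measure.restrict_univ] at h2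
    filter_upwards [h2] with t ht
    simpa using ht
  have meas : MeasurableSet {z : E × ℝ | f (p + z.2 • z.1) ≠ 0} := by
    have : Continuous fun z : E × ℝ => f (p + z.2 • z.1) := by fun_prop
    exact (isOpen_ne_fun this continuous_const).measurableSet
  -- By Fubini, almost every `t` works for almost every `x`. Fixing one such `t ≠ 0`, the affine map
  -- `x ↦ p + t • x` scales `ν` by a nonzero factor, so the zero set itself is null.
  have h := (Measure.ae_ae_comm (μ := ν) (ν := (volume : Measure ℝ))
    (p := fun x t => f (p + t • x) ≠ 0) meas).mp (Filter.Eventually.of_forall line)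
  have h0 : ∀ᵐ t : ℝ, t ≠ 0 := by simp [ae_iff]
  obtain ⟨t, ht, ht0⟩ := (h.and h0).exists
  rw [ae_iff] at ht ⊢
  have e : {x | ¬ f (p + t • x) ≠ 0} = (t • ·) ⁻¹' ((p + ·) ⁻¹' {x | ¬ f x ≠ 0}) := rfl
  rw [e, Measure.addHaar_preimage_smul ν ht0, measure_preimage_add] at ht
  rcases mul_eq_zero.mp ht with h | h
  · rw [ENNReal.ofReal_eq_zero] at h
    have : 0 < |(t ^ Module.finrank ℝ E)⁻¹| := by positivity
    linarith
  · exact h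

/-! ### The star product as a Jordan product, and one generating pair. -/

namespace Bloch

variable {d : ℕ} {ι : Type*} [Fintype ι]

/-- The matrix with a given Bloch vector. -/
noncomputable def blochMatrix (lam : Module.Basis ι ℝ (TracelessHermitian d)) :
    (ι → ℝ) →ₗ[ℝ] Matrix (Fin d) (Fin d) ℂ :=
  (TracelessHermitian d).subtype ∘ₗ lam.equivFun.symm.toLinearMap

theorem blochMatrix_apply (lam : Module.Basis ι ℝ (TracelessHermitian d)) (a : ι → ℝ) :
    blochMatrix lam a = ∑ i, a i • (lam i : Matrix (Fin d) (Fin d) ℂ) := by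
  simp [blochMatrix, Module.Basis.equivFun_symm_apply]

@[simp]
theorem blochMatrix_blochVector (lam : Module.Basis ι ℝ (TracelessHermitian d))
    (H : TracelessHermitian d) : blochMatrix lam (blochVector lam H) = H := by
  simp [blochMatrix, blochVector]

theorem blochMatrix_injective (lam : Module.Basis ι ℝ (TracelessHermitian d)) :
    Function.Injective (blochMatrix lam) :=
  Subtype.val_injective.comp lam.equivFun.symm.injective

theorem trace_blochMatrix (lam : Module.Basis ι ℝ (TracelessHermitian d)) (a : ι → ℝ) :
    (blochMatrix lam a).trace = 0 :=
  (lam.equivFun.symm a).2.2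

/-- The star product is the trace-free part of the Jordan product. -/
theorem blochMatrix_jordan (lam : Module.Basis ι ℝ (TracelessHermitian d))
    (h : IsNormalized lam) (a b : ι → ℝ) :
    blochMatrix lam a * blochMatrix lam b + blochMatrix lam b * blochMatrix lam a =
      (2 : ℝ) • blochMatrix lam (starProd lam a b) +
        (4 / d * ∑ i, a i * b i : ℝ) • (1 : Matrix (Fin d) (Fin d) ℂ) := by
  classical
  have anti : ∀ i j k, antisymmConst lam j i k = -antisymmConst lam i j k := by
    intro i j k
    rw [antisymmConst, antisymmConst, ← neg_div, ← Complex.neg_im, ← Matrix.trace_neg,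
      ← Matrix.neg_mul, neg_sub]
  have symm : ∀ i j k, symmConst lam j i k = symmConst lam i j k := by
    intro i j k
    rw [symmConst, symmConst, add_comm]
  -- Adding `basis_mul_basis` for `(i, j)` and `(j, i)` cancels the antisymmetric constants and
  -- doubles both the symmetric ones and the scalar `2 / d`.
  have key : ∀ i j, (lam i : Matrix (Fin d) (Fin d) ℂ) * lam j +
      (lam j : Matrix (Fin d) (Fin d) ℂ) * lam i =
      (if i = j then (4 / d : ℝ) else 0) • (1 : Matrix (Fin d) (Fin d) ℂ) +
      (2 : ℝ) • ∑ k, symmConst lam i j k • (lam k : Matrix (Fin d) (Fin d) ℂ) := by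
    intro i j
    rw [basis_mul_basis lam h i j, basis_mul_basis lam h j i, add_add_add_comm,
      ← Finset.sum_add_distrib, ← add_smul, Finset.smul_sum]
    congr 1
    · rw [← Complex.coe_smul]
      congr 1
      by_cases hij : i = j
      · subst hij
        simp only [if_true]
        push_cast
        ring
      · simp [hij, Ne.symm hij]
    · refine Finset.sum_congr rfl fun k _ => ?_
      rw [← add_smul, anti i j k, symm i j k, smul_smul, ← Complex.coe_smul]
      congr 1
      push_cast
      ring
  have e : blochMatrix lam a * blochMatrix lam b + blochMatrix lam b * blochMatrix lam a =
      ∑ i, ∑ j, (a i * b j) • ((lam i : Matrix (Fin d) (Fin d) ℂ) * lam j +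
        (lam j : Matrix (Fin d) (Fin d) ℂ) * lam i) := by
    simp only [blochMatrix_apply, Finset.sum_mul_sum, smul_add, Finset.sum_add_distrib,
      smul_mul_smul_comm]
    congr 1
    rw [Finset.sum_comm]
    simp only [mul_comm]
  rw [e]
  simp only [key, smul_add, Finset.sum_add_distrib]
  rw [add_comm]
  congr 1
  · simp only [blochMatrix_apply, starProd, Finset.smul_sum, Finset.sum_smul, smul_smul]
    conv_rhs => rw [Finset.sum_comm]; enter [2, i]; rw [Finset.sum_comm]
    refine Finset.sum_congr rfl fun i _ => Finset.sum_congr rfl fun j _ =>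
      Finset.sum_congr rfl fun k _ => ?_
    congr 1
    ring
  · simp [smul_smul, ← Finset.sum_smul, Finset.mul_sum, mul_comm]

theorem span_starProducts_eq_top (lam : Module.Basis ι ℝ (TracelessHermitian d))
    (h : IsNormalized lam) (hd : 3 ≤ d) {a : Fin d → ℝ} (ha : Function.Injective a)
    (hA : Matrix.diagonal (fun i => (a i : ℂ)) ∈ TracelessHermitian d) {B : Set (ι → ℝ)}
    (hAB : blochVector lam ⟨_, hA⟩ ∈ B) (hB : blochVector lam ⟨_, skewOnes_mem d⟩ ∈ B) :
    Submodule.span ℝ (starProducts lam B) = ⊤ := by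
  set V := Submodule.span ℝ (starProducts lam B) with hV
  have hmul : ∀ x ∈ V, ∀ y ∈ V, starProd lam x y ∈ V := by
    let S : (ι → ℝ) →ₗ[ℝ] (ι → ℝ) →ₗ[ℝ] (ι → ℝ) := LinearMap.mk₂ ℝ (starProd lam)
      (fun x y z => by ext; simp [starProd, mul_add, add_mul, Finset.sum_add_distrib])
      (fun c x y => by ext; simp [starProd, Finset.mul_sum]; congr! 2; ring)
      (fun x y z => by ext; simp [starProd, mul_add, Finset.sum_add_distrib])
      (fun c x y => by ext; simp [starProd, Finset.mul_sum]; congr! 2; ring)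
    intro x hx y hy
    change S x y ∈ V
    induction hx, hy using Submodule.span_induction₂ with
    | mem_mem x y hx hy => exact Submodule.subset_span (.mul hx hy)
    | zero_left y hy => simp
    | zero_right x hx => simp
    | add_left x y z _ _ _ h1 h2 => simpa using V.add_mem h1 h2
    | add_right x y z _ _ _ h1 h2 => simpa using V.add_mem h1 h2
    | smul_left r x y _ _ h1 => simpa using V.smul_mem r h1
    | smul_right r x y _ _ h1 => simpa using V.smul_mem r h1
  -- The identity is adjoined because the Jordan product has a scalar part that the star product
  -- discards.
  let J : Submodule ℝ (Matrix (Fin d) (Fin d) ℂ) := V.map (blochMatrix lam) ⊔ Submodule.span ℝ {1}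
  have memJ : ∀ {X}, X ∈ J ↔ ∃ x ∈ V, ∃ c : ℝ, X = blochMatrix lam x + c • 1 := by
    intro X
    simp only [J, Submodule.mem_sup, Submodule.mem_map, Submodule.mem_span_singleton]
    constructor
    · rintro ⟨_, ⟨x, hx, rfl⟩, _, ⟨c, rfl⟩, rfl⟩
      exact ⟨x, hx, c, rfl⟩
    · rintro ⟨x, hx, c, rfl⟩
      exact ⟨_, ⟨x, hx, rfl⟩, _, ⟨c, rfl⟩, rfl⟩
  have hgen : ∀ H : TracelessHermitian d, blochVector lam H ∈ B → H.1 ∈ J := fun H hH =>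
    memJ.mpr ⟨_, Submodule.subset_span (.base hH), 0, by simp⟩
  have hJ : ∀ X ∈ J, ∀ Y ∈ J, X * Y + Y * X ∈ J := by
    intro X hX Y hY
    obtain ⟨x, hx, c, rfl⟩ := memJ.mp hX
    obtain ⟨y, hy, e, rfl⟩ := memJ.mp hY
    -- Coefficients from expanding the Jordan product of `x + c • 1` and `y + e • 1`.
    refine memJ.mpr ⟨(2 : ℝ) • starProd lam x y + (2 * e) • x + (2 * c) • y,
      V.add_mem (V.add_mem (V.smul_mem _ (hmul x hx y hy)) (V.smul_mem _ hx)) (V.smul_mem _ hy),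
      4 / d * ∑ i, x i * y i + 2 * c * e, ?_⟩
    have h3 := blochMatrix_jordan lam h x y
    simp only [map_add, map_smul]
    rw [add_smul, show ∀ P Q R S T : Matrix (Fin d) (Fin d) ℂ,
      P + Q + R + (S + T) = (P + S) + Q + R + T by intros; abel, ← h3]
    simp only [mul_add, add_mul, smul_mul_assoc, mul_smul_comm, one_mul, mul_one]
    module
  rw [eq_top_iff]
  intro v _
  have hv : blochMatrix lam v ∈ J := hermitian_mem_of_jordan hd hJ
    (memJ.mpr ⟨0, V.zero_mem, 1, by simp⟩) ha (hgen _ hAB) (hgen _ hB) (lam.equivFun.symm v).2.1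
  obtain ⟨x, hx, c, e⟩ := memJ.mp hv
  -- Both Bloch matrices are traceless, so the scalar part must vanish and the vector already lies
  -- in `V`.
  have ht := congrArg Matrix.trace e
  simp only [Matrix.trace_add, trace_blochMatrix, Matrix.trace_smul, Matrix.trace_one,
    Fintype.card_fin, zero_add] at ht
  have hc : c = 0 := by
    by_contra hc
    have : (d : ℂ) ≠ 0 := by norm_cast; omega
    exact smul_ne_zero hc this ht.symm
  rw [hc, zero_smul, add_zero] at e
  rwa [blochMatrix_injective lam e]

theorem exists_injective_diagonal_mem (hd : 3 ≤ d) :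
    ∃ a : Fin d → ℝ, Function.Injective a ∧
      Matrix.diagonal (fun i => (a i : ℂ)) ∈ TracelessHermitian d := by
  -- The entries `0, …, d - 1`, shifted by their mean to make the trace zero.
  refine ⟨fun i => (i : ℝ) - (∑ j : Fin d, (j : ℝ)) / d, ?_, ?_, ?_⟩
  · intro i j hij
    simpa [Fin.ext_iff] using hij
  · rw [Matrix.isHermitian_diagonal_iff]
    intro i
    simp [isSelfAdjoint_iff]
  · have : (d : ℂ) ≠ 0 := by norm_cast; omega
    simp only [Matrix.trace_diagonal]
    push_cast
    rw [Finset.sum_sub_distrib]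
    simp only [Finset.sum_const, Finset.card_univ, Fintype.card_fin, nsmul_eq_mul]
    field_simp
    simp

/-! ### From one generating family to almost every family. -/

/-- Keeping the bracketing of `x` and letting the factors vary gives a polynomial map of the family,
whose value is an iterated product at every `q`. -/
theorem exists_analytic_starProducts {m : ℕ} (lam : Module.Basis ι ℝ (TracelessHermitian d))
    (p : Fin m → ι → ℝ) {x : ι → ℝ} (hx : x ∈ starProducts lam (Set.range p)) :
    ∃ f : (Fin m → ι → ℝ) → ι → ℝ, f p = x ∧
      (∀ q, f q ∈ starProducts lam (Set.range q)) ∧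
      ∀ ξ, AnalyticOnNhd ℝ (fun q => f q ξ) Set.univ := by
  induction hx with
  | base hb =>
    obtain ⟨i, rfl⟩ := hb
    refine ⟨fun q => q i, rfl, fun q => .base ⟨i, rfl⟩, fun ξ => ?_⟩
    exact ((ContinuousLinearMap.proj (R := ℝ) (φ := fun _ : ι => ℝ) ξ).comp
      (ContinuousLinearMap.proj (R := ℝ) (φ := fun _ : Fin m => ι → ℝ) i)).analyticOnNhd _
  | mul _ _ iha ihb =>
    obtain ⟨f, rfl, hf, hfa⟩ := iha
    obtain ⟨g, rfl, hg, hga⟩ := ihb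
    refine ⟨fun q => starProd lam (f q) (g q), rfl, fun q => .mul (hf q) (hg q), fun ξ => ?_⟩
    refine Finset.analyticOnNhd_fun_sum _ fun μ _ => Finset.analyticOnNhd_fun_sum _ fun ν _ => ?_
    exact (analyticOnNhd_const.mul (hfa μ)).mul (hga ν)

/-- If one family of Bloch vectors generates, then almost every family does. -/
theorem ae_span_starProducts_eq_top {m : ℕ} (lam : Module.Basis ι ℝ (TracelessHermitian d))
    (ν : Measure (Fin m → ι → ℝ)) [ν.IsAddHaarMeasure] {p : Fin m → ι → ℝ}
    (hp : Submodule.span ℝ (starProducts lam (Set.range p)) = ⊤) :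
    ∀ᵐ q ∂ν, Submodule.span ℝ (starProducts lam (Set.range q)) = ⊤ := by
  classical
  obtain ⟨s, hs, b, hb⟩ := exists_linearIndependent ℝ (starProducts lam (Set.range p))
  let e := Module.Basis.mk hb (by rw [Subtype.range_coe, b, hp])
  -- The selected products form a basis, so they can be indexed by `ι`; this makes the coordinate
  -- matrix square.
  let σ : ι ≃ s := (Pi.basisFun ℝ ι).indexEquiv e
  choose f hfp hfm hfa using fun i : ι => exists_analytic_starProducts lam p (hs (σ i).2)
  let D : (Fin m → ι → ℝ) → ℝ := fun q => (Matrix.of fun i => f i q).det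
  have hD : AnalyticOnNhd ℝ D Set.univ := by
    simp only [D, Matrix.det_apply]
    refine Finset.analyticOnNhd_fun_sum _ fun τ _ => ?_
    refine AnalyticOnNhd.const_smul ?_
    exact Finset.analyticOnNhd_fun_prod _ fun i _ => hfa _ _
  have iff : ∀ q, D q ≠ 0 ↔ LinearIndependent ℝ fun i => f i q := by
    intro q
    rw [← isUnit_iff_ne_zero, ← Matrix.isUnit_iff_isUnit_det,
      ← Matrix.linearIndependent_rows_iff_isUnit]
    rfl
  have hDp : D p ≠ 0 := by
    rw [iff]
    simp only [hfp]
    exact hb.comp σ σ.injective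
  filter_upwards [hD.ae_ne_zero ν hDp] with q hq
  have h := ((iff q).mp hq).span_eq_top_of_card_eq_finrank' (by simp)
  rw [eq_top_iff, ← h]
  refine Submodule.span_mono ?_
  rintro _ ⟨i, rfl⟩
  exact hfm i q

/-- All bases have equal size, so it suffices to count the Gell-Mann indices: the pairs above and
below the diagonal and the `d` diagonal pairs exhaust the `d ^ 2` pairs, and tracelessness costs one
diagonal index. -/
theorem card_basis (lam : Module.Basis ι ℝ (TracelessHermitian d)) (hd : 0 < d) :
    Fintype.card ι = d ^ 2 - 1 := by
  rw [← Module.finrank_eq_card_basis lam, Module.finrank_eq_card_basis (gellMannBasis d)]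
  have h : (Fintype.card {p : Fin d × Fin d // p.1 < p.2} +
      Fintype.card {p : Fin d × Fin d // p.1 < p.2}) + d = d ^ 2 := by
    have h1 : Fintype.card {p : Fin d × Fin d // p.1 < p.2} =
        Fintype.card {p : Fin d × Fin d // p.2 < p.1} :=
      Fintype.card_congr ((Equiv.prodComm _ _).subtypeEquiv fun p => Iff.rfl)
    have h2 : Fintype.card {p : Fin d × Fin d // p.2 ≤ p.1} =
        Fintype.card {p : Fin d × Fin d // p.2 < p.1} +
        Fintype.card {p : Fin d × Fin d // p.2 = p.1} := by
      simp only [le_iff_lt_or_eq]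
      exact Fintype.card_subtype_or_disjoint _ _
        (Pi.disjoint_iff.mpr fun p => by simpa [Prop.disjoint_iff] using fun h => h.ne)
    have h3 : Fintype.card {p : Fin d × Fin d // p.2 = p.1} = d := by
      rw [Fintype.card_congr (β := Fin d) ⟨fun p => p.1.1, fun i => ⟨(i, i), rfl⟩,
        fun ⟨⟨i, j⟩, h⟩ => by simpa using h.symm, fun i => rfl⟩, Fintype.card_fin]
    have h4 := Fintype.card_subtype_compl fun p : Fin d × Fin d => p.1 < p.2
    have h5 := Fintype.card_subtype_le fun p : Fin d × Fin d => p.1 < p.2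
    simp only [not_lt, Fintype.card_prod, Fintype.card_fin] at h4 h5
    rw [sq]
    omega
  simp only [Fintype.card_sum, Fintype.card_fin]
  omega

end Bloch

theorem mainTheorem3 (d m : ℕ) (hd : 3 ≤ d) (hm : 2 ≤ m)
    {ι : Type*} [Fintype ι]
    (lam : Module.Basis ι ℝ (TracelessHermitian d)) (hlam : Bloch.IsNormalized lam)
    (μ : Measure (Fin m → TracelessHermitian d)) [μ.IsAddHaarMeasure] :
    ∀ᵐ H ∂μ,
      Module.finrank ℝ (Submodule.span ℝ
        (Bloch.starProducts lam (Set.range fun i => Bloch.blochVector lam (H i)))) = d ^ 2 - 1 ∧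
      Submodule.span ℝ
        (Bloch.starProducts lam (Set.range fun i => Bloch.blochVector lam (H i))) = ⊤ := by
  -- Bloch coordinates are a linear homeomorphism, so `μ` pushes forward to a Haar measure and null
  -- sets can be found in coordinates.
  let e : (Fin m → TracelessHermitian d) ≃L[ℝ] (Fin m → ι → ℝ) :=
    ContinuousLinearEquiv.piCongrRight fun _ => lam.equivFunL
  have hν : (μ.map e).IsAddHaarMeasure := inferInstance
  obtain ⟨a, ha, hA⟩ := Bloch.exists_injective_diagonal_mem hd
  -- Index 0 carries the diagonal matrix and every other index carries `skewOnes d`; `2 ≤ m` ensures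
  -- that index 1 exists.
  let p : Fin m → ι → ℝ := fun i => Bloch.blochVector lam
    (if (i : ℕ) = 0 then ⟨_, hA⟩ else ⟨_, skewOnes_mem d⟩)
  have hp : Submodule.span ℝ (Bloch.starProducts lam (Set.range p)) = ⊤ :=
    Bloch.span_starProducts_eq_top lam hlam hd ha hA ⟨⟨0, by omega⟩, by simp [p]⟩
      ⟨⟨1, by omega⟩, by simp [p]⟩
  have h := Bloch.ae_span_starProducts_eq_top lam (μ.map e) hp
  have h2 := ae_of_ae_map e.continuous.measurable.aemeasurable h
  filter_upwards [h2] with H hH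
  have hH' : Submodule.span ℝ
      (Bloch.starProducts lam (Set.range fun i => Bloch.blochVector lam (H i))) = ⊤ := hH
  refine ⟨?_, hH'⟩
  rw [hH', finrank_top, Module.finrank_fintype_fun_eq_card, Bloch.card_basis lam (by omega)]
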